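/- Let $r\ge 1$, let $q_{i,j}\ge 0$ ($1\le i\ne j\le r$), $q_i=\sum_{j\ne i}q_{i,j}$, let $Q$ be the $r\times r$ matrix with off-diagonal entries $q_{i,j}$ and diagonal entries $-q_i$, let $\lambda_1,\dots,\lambda_r\ge 0$ and $\Lambda=\mathrm{diag}(\lambda_1,\dots,\lambda_r)$, and let $\gamma:[0,\infty)\to[0,\infty)$ be of bounded variation on bounded intervals. Let $\{M(t),N_M(t);t\ge 0\}$ be a Markov-modulated non-homogeneous Poisson process with these parameters: $M$ is a right-continuous continuous-time Markov chain on $\{1,\dots,r\}$ with transition intensities $q_{i,j}$ (that is, $\mathbb P[M(t+h)=j\mid M(t)=i]=q_{i,j}h+o(h)$ as $h\downarrow 0$, uniformly in $t$, for $i\ne j$) and arbitrary initial law, and $N_M$ is a counting process with $N_M(0)=0$ which, conditionally on the path of $M$, is a Poisson process with intensity $\lambda_{M(u)}\gamma(u)$ at time $u$. Let $t,t^*\ge 0$ and suppose that $\gamma$ is constant, equal to $\gamma_{t^*}$, on $[t,t+t^*)$. Then the probabilities of regime transitions without any event arrivals by time $t+t^*$, given the regime at time $t$, $$\bar F_{i,j}(t,t^*)=\mathbb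 P[M(t+t^*)=j,\ N_M(t+t^*)=N_M(t)\mid M(t)=i],$$ are given in matrix form by $$\bar{\boldsymbol F}(t,t^*)=\exp\left[(Q-\Lambda\gamma_{t^*})\,t^*\right],$$ and the same holds for the probabilities $\mathbb P[M(t+t^*)=j,\ N_M(t+t^*)=n\mid M(t)=i,\ N_M(t)=n]$ for every $n\in\mathbb N$. Here each row $i$ is asserted whenever the event conditioned on has positive probability. -/

import Mathlib

open MeasureTheory ProbabilityTheory Set
open scoped Nat

/-- The intensity matrix `Q` of a continuous-time Markov chain with transition intensities `q i j`,
`i ≠ j`: the off-diagonal entries are the `q i j`, the diagonal entries are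
`-q_i = -∑_{k ≠ i} q i k`. (The values `q i i` play no role.) -/
def rateMatrix {r : ℕ} (q : Fin r → Fin r → ℝ) : Matrix (Fin r) (Fin r) ℝ :=
  Matrix.of fun i j => if i = j then -∑ k ∈ Finset.univ.erase i, q i k else q i j

/-- The σ-algebra generated by the process `X` at the times belonging to `I`. -/
@[reducible] def sigmaOf {Ω S : Type*} [MeasurableSpace S] (X : ℝ → Ω → S) (I : Set ℝ) : MeasurableSpace Ω :=
  ⨆ s ∈ I, MeasurableSpace.comap (X s) inferInstance

/-- `M = (M t)_{t ≥ 0}` is a continuous-time Markov chain with state space `Fin r`, with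
right-continuous paths and constant transition intensities `q i j` from `i` to `j ≠ i`
(infinitesimal definition). Only times `t ≥ 0` matter; the initial law is arbitrary. -/
structure IsMarkovChainWithRates {Ω : Type*} [MeasurableSpace Ω] (P : Measure Ω) {r : ℕ}
    (q : Fin r → Fin r → ℝ) (M : ℝ → Ω → Fin r) : Prop where
  measurable : ∀ t, 0 ≤ t → Measurable (M t)
  rightContinuous : ∀ᵐ ω ∂P, ∀ t, 0 ≤ t → ContinuousWithinAt (fun s => M s ω) (Ici t) t
  /-- Markov property: given `M t = i`, the state `M (t + h)` is independent of
  `(M s)_{0 ≤ s ≤ t}`. -/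
  markov : ∀ t h : ℝ, 0 ≤ t → 0 ≤ h → ∀ i : Fin r, P (M t ⁻¹' {i}) ≠ 0 →
    Indep (sigmaOf M (Icc 0 t)) (sigmaOf M {t + h}) (P[|M t ⁻¹' {i}])
  /-- `P(M (t + h) = j | M t = i) = q i j * h + o(h)` as `h ↓ 0`, uniformly in `t`. -/
  intensity : ∀ i j : Fin r, i ≠ j → ∀ ε : ℝ, 0 < ε → ∃ δ : ℝ, 0 < δ ∧
    ∀ t h : ℝ, 0 ≤ t → 0 < h → h < δ → P (M t ⁻¹' {i}) ≠ 0 →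
      |(P[|M t ⁻¹' {i}]).real (M (t + h) ⁻¹' {j}) - q i j * h| ≤ ε * h

/-- The cumulative intensity `∫_s^t lam_{M(u)} γ(u) du` of the event arrivals on `(s, t]`. -/
noncomputable def cumulativeIntensity {Ω : Type*} {r : ℕ} (lam : Fin r → ℝ) (γ : ℝ → ℝ)
    (M : ℝ → Ω → Fin r) (s t : ℝ) (ω : Ω) : ℝ :=
  ∫ u in s..t, lam (M u ω) * γ u

/-- `(M, N)` is a Markov-modulated non-homogeneous Poisson process with regime transition
intensities `q`, regime event intensities `lam` and exposure `γ`: the regime process `M` is a Markov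
chain with intensities `q`, and `N` is a counting process which, conditionally on the whole path of
`M`, is a Poisson process with intensity `lam (M u) * γ u` at time `u`. -/
structure IsMMNPP {Ω : Type*} [MeasurableSpace Ω] (P : Measure Ω) {r : ℕ}
    (q : Fin r → Fin r → ℝ) (lam : Fin r → ℝ) (γ : ℝ → ℝ)
    (M : ℝ → Ω → Fin r) (N : ℝ → Ω → ℕ) : Prop where
  chain : IsMarkovChainWithRates P q M
  measurable : ∀ t, 0 ≤ t → Measurable (N t)
  start : ∀ᵐ ω ∂P, N 0 ω = 0
  monotone : ∀ᵐ ω ∂P, MonotoneOn (fun t => N t ω) (Ici 0)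
  rightContinuous : ∀ᵐ ω ∂P, ∀ t, 0 ≤ t → ContinuousWithinAt (fun s => N s ω) (Ici t) t
  /-- Given `M`, the increments of `N` over consecutive intervals `(τ k, τ (k + 1)]` are independent
  and Poisson distributed, with means the cumulative intensities. -/
  condPoisson : ∀ (m : ℕ) (τ : ℕ → ℝ) (n : ℕ → ℕ), Monotone τ → 0 ≤ τ 0 →
    P[({ω | ∀ k < m, N (τ (k + 1)) ω = N (τ k) ω + n k}).indicator (fun _ => (1 : ℝ)) |
        sigmaOf M (Ici 0)] =ᵐ[P]
      fun ω => ∏ k ∈ Finset.range m,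
        (Real.exp (-cumulativeIntensity lam γ M (τ k) (τ (k + 1)) ω) *
          cumulativeIntensity lam γ M (τ k) (τ (k + 1)) ω ^ n k / (n k)!)

/-- The matrix of the probabilities of regime transitions without event arrivals over a span `s`
from time `t`: its `(i, j)` entry is `P(M (t + s) = j, N (t + s) = N t | M t = i)`. -/
noncomputable def noArrivalMatrix {Ω : Type*} [MeasurableSpace Ω] (P : Measure Ω) {r : ℕ}
    (M : ℝ → Ω → Fin r) (N : ℝ → Ω → ℕ) (t s : ℝ) : Matrix (Fin r) (Fin r) ℝ :=
  Matrix.of fun i j =>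
    (P[|{ω | M t ω = i}]).real {ω | M (t + s) ω = j ∧ N (t + s) ω = N t ω}

/-- The same matrix when one conditions in addition on `n` events having occurred by time `t`:
its `(i, j)` entry is `P(M (t + s) = j, N (t + s) = n | M t = i, N t = n)`. -/
noncomputable def noArrivalMatrixGiven {Ω : Type*} [MeasurableSpace Ω] (P : Measure Ω) {r : ℕ}
    (M : ℝ → Ω → Fin r) (N : ℝ → Ω → ℕ) (n : ℕ) (t s : ℝ) : Matrix (Fin r) (Fin r) ℝ :=
  Matrix.of fun i j =>
    (P[|{ω | M t ω = i ∧ N t ω = n}]).real {ω | M (t + s) ω = j ∧ N (t + s) ω = n}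

open Filter Topology

/-! Given the whole path of `M`, no event falls in `(t, t + s]` with probability `exp (-∫ g * lam (M
u) du)`. After conditioning on the path, both assertions therefore concern `M` alone: one needs the
expectation of `X * exp (-∫ κ (M u) du)` on `{M t = i, M (t + s) = j}`, where `κ = g * lam` and `X`
depends on the path up to time `t`. For the first assertion `X = 1`; for the second `X` is the
Poisson weight of `n` events on `(0, t]`.

This expectation is computed by a Feynman–Kac argument (`setIntegral_exp_neg_cumulativeIntensity`).
Let `u s j` be the expectation of `X` times the exponential on `{M (t + s) = j}`. Over a further
step `h`, the Markov property and the intensities give the transition factor `1 + h Q + o(h)`. The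
chain is away from its current state `k` at a given time of the step with probability `O(h)` only,
so replacing the integral by `κ k * h` costs `O(h ^ 2)`. Hence `u (s + h) = u s + h • (u s ᵥ* (Q -
diag κ)) + o(h)`, uniformly in `s` (`eventually_abs_setIntegral_sub_le`), and uniqueness for linear
ODEs identifies `u` with the matrix exponential (`eq_vecMul_exp_of_eventually_abs_sub_le`).
Inserting the indicator of `{M t = i}` into `X` isolates row `i`. -/

theorem measurable_sigmaOf {Ω S : Type*} [MeasurableSpace S] (X : ℝ → Ω → S) {I : Set ℝ} {s : ℝ}
    (hs : s ∈ I) : Measurable[sigmaOf X I] (X s) :=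
  (comap_measurable (X s)).mono
    (le_iSup₂ (f := fun s _ => MeasurableSpace.comap (X s) inferInstance) s hs) le_rfl

theorem sigmaOf_le {Ω S : Type*} [mΩ : MeasurableSpace Ω] [MeasurableSpace S] {X : ℝ → Ω → S}
    {I : Set ℝ} (h : ∀ s ∈ I, Measurable (X s)) : sigmaOf X I ≤ mΩ :=
  iSup₂_le fun s hs => (h s hs).comap_le

theorem sigmaOf_mono {Ω S : Type*} [MeasurableSpace S] (X : ℝ → Ω → S) {I J : Set ℝ}
    (h : I ⊆ J) : sigmaOf X I ≤ sigmaOf X J :=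
  biSup_mono h

/-! ### Discretisation in time and measurability of path functionals -/

/-- The approximation of `u` from the right by multiples of `1 / (n + 1)`, truncated at `b`. -/
noncomputable def rightStep (n : ℕ) (b u : ℝ) : ℝ := min (⌈u * (n + 1 : ℝ)⌉₊ / (n + 1 : ℝ)) b

theorem le_rightStep (n : ℕ) {b u : ℝ} (hub : u ≤ b) : u ≤ rightStep n b u := by
  refine le_min ?_ hub
  rw [le_div_iff₀ (by positivity)]
  exact Nat.le_ceil _

theorem tendsto_rightStep {b u : ℝ} (hu : 0 ≤ u) (hub : u ≤ b) :
    Tendsto (fun n => rightStep n b u) atTop (𝓝[≥] u) := by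
  refine tendsto_nhdsWithin_iff.2 ⟨?_, Eventually.of_forall fun n => le_rightStep n hub⟩
  have h1 : Tendsto (fun n : ℕ => (n + 1 : ℝ)) atTop atTop :=
    tendsto_atTop_add_const_right _ _ tendsto_natCast_atTop_atTop
  have h2 := ((tendsto_nat_ceil_mul_div_atTop hu).comp h1).min (tendsto_const_nhds (x := b))
  rwa [min_eq_left hub] at h2

/-- The approximant samples `X` at countably many times, which gives joint measurability. Truncation
at `b` keeps these times in `[0, b]`, so the σ-algebra on `Ω` may be taken to be the past up to `b`.
-/
theorem measurable_comp_rightStep {Ω S E : Type*} [MeasurableSpace Ω] [MeasurableSpace S]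
    [MeasurableSpace E] {X : ℝ → Ω → S} {b : ℝ} (hb : 0 ≤ b)
    (hX : ∀ s ∈ Icc 0 b, Measurable (X s)) {f : S → E} (hf : Measurable f) (n : ℕ) :
    Measurable fun p : Ω × ℝ => f (X (rightStep n b p.2) p.1) := by
  have h : Measurable fun p : Ω × ℕ => f (X (min (p.2 / (n + 1 : ℝ)) b) p.1) := by
    refine measurable_from_prod_countable_left fun k => ?_
    exact hf.comp (hX (min (k / (n + 1 : ℝ)) b) ⟨le_min (by positivity) hb, min_le_right _ _⟩)
  have h2 : Measurable fun p : Ω × ℝ => (p.1, ⌈p.2 * (n + 1 : ℝ)⌉₊) :=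
    measurable_fst.prodMk (Nat.measurable_ceil.comp (measurable_snd.mul_const _))
  exact h.comp h2

theorem stronglyMeasurable_integral_rightStep {Ω S : Type*} [MeasurableSpace Ω]
    [MeasurableSpace S] {X : ℝ → Ω → S} {a b : ℝ} (hb : 0 ≤ b)
    (hX : ∀ s ∈ Icc 0 b, Measurable (X s)) {f : S → ℝ} (hf : Measurable f) {w : ℝ → ℝ}
    (hw : Measurable w) (n : ℕ) :
    StronglyMeasurable fun ω => ∫ u in Ioc a b, f (X (rightStep n b u) ω) * w u :=
  StronglyMeasurable.integral_prod_right'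
    (f := fun p : Ω × ℝ => f (X (rightStep n b p.2) p.1) * w p.2)
    (((measurable_comp_rightStep hb hX hf n).mul (hw.comp measurable_snd)).stronglyMeasurable)

namespace IsMarkovChainWithRates

variable {Ω : Type*} [MeasurableSpace Ω] {P : Measure Ω} {r : ℕ} {q : Fin r → Fin r → ℝ}
  {M : ℝ → Ω → Fin r}

theorem ae_tendsto_rightStep (hM : IsMarkovChainWithRates P q M) (f : Fin r → ℝ) :
    ∀ᵐ ω ∂P, ∀ b u, 0 ≤ u → u ≤ b →
      Tendsto (fun n => f (M (rightStep n b u) ω)) atTop (𝓝 (f (M u ω))) := by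
  filter_upwards [hM.rightContinuous] with ω hω b u hu hub
  exact ((continuous_of_discreteTopology (f := f)).tendsto _).comp
    ((hω u hu).tendsto.comp (tendsto_rightStep hu hub))

theorem sigmaOf_Icc_le (hM : IsMarkovChainWithRates P q M) (b : ℝ) :
    sigmaOf M (Icc 0 b) ≤ ‹MeasurableSpace Ω› :=
  sigmaOf_le fun s hs => hM.measurable s hs.1

theorem aemeasurable_prod [SFinite P] (hM : IsMarkovChainWithRates P q M) (f : Fin r → ℝ)
    {a b : ℝ} (ha : 0 ≤ a) (hab : a ≤ b) :
    AEMeasurable (fun p : Ω × ℝ => f (M p.2 p.1)) (P.prod (volume.restrict (Ioc a b))) := by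
  have h0 : ∀ n, Measurable fun p : Ω × ℝ => f (M (rightStep n b p.2) p.1) := fun n =>
    measurable_comp_rightStep (ha.trans hab) (fun s hs => hM.measurable s hs.1)
      (measurable_of_finite f) n
  have h1 := Measure.quasiMeasurePreserving_fst.ae (μa := P.prod (volume.restrict (Ioc a b)))
    (hM.ae_tendsto_rightStep f)
  have h2 := Measure.quasiMeasurePreserving_snd.ae (μa := P.prod (volume.restrict (Ioc a b)))
    (ae_restrict_mem measurableSet_Ioc)
  refine aemeasurable_of_tendsto_metrizable_ae atTop (fun n => (h0 n).aemeasurable) ?_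
  filter_upwards [h1, h2] with p hp1 hp2
  exact hp1 b p.2 (ha.trans hp2.1.le) hp2.2

/-- The exponential weights must be functionals of the past for the Markov property to apply to
them. By dominated convergence the integral is almost surely the limit of integrals of discretised
paths, which are measurable for the past. -/
theorem aestronglyMeasurable_cumulativeIntensity (hM : IsMarkovChainWithRates P q M)
    (lam : Fin r → ℝ) {γ : ℝ → ℝ} {a b : ℝ} (ha : 0 ≤ a) (hab : a ≤ b)
    (hγ : IntervalIntegrable γ volume a b) :
    AEStronglyMeasurable[sigmaOf M (Icc 0 b)] (cumulativeIntensity lam γ M a b) P := by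
  have hγ' : IntegrableOn γ (Ioc a b) := (intervalIntegrable_iff_integrableOn_Ioc_of_le hab).1 hγ
  let w := hγ'.aestronglyMeasurable.mk γ
  have hw : StronglyMeasurable w := hγ'.aestronglyMeasurable.stronglyMeasurable_mk
  have hwγ : γ =ᵐ[volume.restrict (Ioc a b)] w := hγ'.aestronglyMeasurable.ae_eq_mk
  let F : ℕ → Ω → ℝ := fun n ω => ∫ u in Ioc a b, lam (M (rightStep n b u) ω) * w u
  have hX : ∀ s ∈ Icc 0 b, Measurable[sigmaOf M (Icc 0 b)] (M s) :=
    fun s hs => measurable_sigmaOf M hs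
  have hF : ∀ n, StronglyMeasurable[sigmaOf M (Icc 0 b)] (F n) := fun n =>
    @stronglyMeasurable_integral_rightStep _ _ (sigmaOf M (Icc 0 b)) _ _ _ _ (ha.trans hab)
      hX _ (measurable_of_finite lam) _ hw.measurable n
  -- Paths are right-continuous only almost surely and the σ-algebra of the past is not completed.
  -- `limUnder` is measurable for it without discarding a null set.
  refine ⟨fun ω => limUnder atTop fun n => F n ω, 
    @StronglyMeasurable.limUnder _ _ _ (sigmaOf M (Icc 0 b)) _ _ _ _ _ _ _ hF, ?_⟩
  filter_upwards [hM.ae_tendsto_rightStep lam] with ω hω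
  refine (Tendsto.limUnder_eq ?_).symm
  rw [cumulativeIntensity, intervalIntegral.integral_of_le hab]
  obtain ⟨B, hB⟩ := (Set.finite_range fun i => |lam i|).bddAbove
  refine tendsto_integral_of_dominated_convergence (fun u => B * |w u|) ?_ ?_ ?_ ?_
  · intro n
    refine (Measurable.mul (measurable_of_finite lam |>.comp ?_) hw.measurable).aestronglyMeasurable
    have h : Measurable fun k : ℕ => M (min (k / (n + 1 : ℝ)) b) ω := measurable_of_countable _
    exact h.comp (Nat.measurable_ceil.comp (measurable_id.mul_const _))
  · exact ((hγ'.congr hwγ).abs).const_mul B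
  · intro n
    refine Eventually.of_forall fun u => ?_
    rw [Real.norm_eq_abs, abs_mul]
    exact mul_le_mul_of_nonneg_right (hB ⟨_, rfl⟩) (abs_nonneg _)
  · filter_upwards [hwγ, ae_restrict_mem measurableSet_Ioc] with u hu hu'
    rw [hu]
    exact (hω b u (ha.trans hu'.1.le) hu'.2).mul_const _

/-- Almost every path is integrable over compact intervals, after composition with any function. -/
theorem ae_intervalIntegrable (hM : IsMarkovChainWithRates P q M) (f : Fin r → ℝ) :
    ∀ᵐ ω ∂P, ∀ a b, 0 ≤ a → a ≤ b → IntervalIntegrable (fun u => f (M u ω)) volume a b := by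
  filter_upwards [hM.ae_tendsto_rightStep f] with ω hω a b ha hab
  obtain ⟨B, hB⟩ := (Set.finite_range fun i => |f i|).bddAbove
  rw [intervalIntegrable_iff_integrableOn_Ioc_of_le hab]
  refine Integrable.of_bound ?_ B (Eventually.of_forall fun u => hB ⟨_, rfl⟩)
  refine aestronglyMeasurable_of_tendsto_ae atTop (f := fun n u => f (M (rightStep n b u) ω)) ?_ ?_
  · intro n
    refine (Measurable.aestronglyMeasurable (measurable_of_finite f |>.comp ?_))
    have h : Measurable fun k : ℕ => M (min (k / (n + 1 : ℝ)) b) ω := measurable_of_countable _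
    exact h.comp (Nat.measurable_ceil.comp (measurable_id.mul_const _))
  · filter_upwards [ae_restrict_mem measurableSet_Ioc] with u hu'
    exact hω b u (ha.trans hu'.1.le) hu'.2

end IsMarkovChainWithRates

/-! ### Elementary inequalities and decomposition along fibres -/

theorem abs_exp_neg_sub_exp_neg_le {x y : ℝ} (hx : 0 ≤ x) (hy : 0 ≤ y) :
    |Real.exp (-x) - Real.exp (-y)| ≤ |x - y| := by
  wlog h : x ≤ y generalizing x y
  · rw [abs_sub_comm, abs_sub_comm x]
    exact this hy hx (le_of_not_ge h)
  have h1 : Real.exp (-y) ≤ Real.exp (-x) := Real.exp_le_exp.2 (by linarith)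
  rw [abs_of_nonneg (by linarith), abs_of_nonpos (by linarith)]
  have h2 : Real.exp (-y) = Real.exp (-x) * Real.exp (x - y) := by
    rw [← Real.exp_add]; ring_nf
  have h3 : Real.exp (-x) ≤ 1 := Real.exp_le_one_iff.2 (by linarith)
  have h4 := Real.add_one_le_exp (x - y)
  have h5 := Real.exp_pos (-x)
  nlinarith

/-- To be used with `p` a transition probability, `d` the Kronecker delta, `c = h * Q k j` and `a =
κ k * h`: the error is then `o(h)`. -/
theorem abs_mul_exp_neg_sub_le {p d c a e : ℝ} (hp0 : 0 ≤ p) (hp1 : p ≤ 1) (ha0 : 0 ≤ a)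
    (ha1 : a ≤ 1) (hp : |p - d - c| ≤ e) :
    |p * Real.exp (-a) - (d + (c - a * d))| ≤ a ^ 2 + e + a * (e + |c|) := by
  have h1 : |Real.exp (-a) - 1 - -a| ≤ (-a) ^ 2 :=
    Real.abs_exp_sub_one_sub_id_le (by rwa [abs_neg, abs_of_nonneg ha0])
  have h2 : |p - d| ≤ e + |c| := by
    calc |p - d| = |(p - d - c) + c| := by ring_nf
      _ ≤ _ := (abs_add_le _ _).trans (by linarith)
  calc |p * Real.exp (-a) - (d + (c - a * d))|
      = |p * (Real.exp (-a) - 1 - -a) + (p - d - c) - a * (p - d)| := by ring_nf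
    _ ≤ |p * (Real.exp (-a) - 1 - -a)| + |p - d - c| + |a * (p - d)| :=
        (abs_sub _ _).trans (add_le_add_left (abs_add_le _ _) _)
    _ ≤ _ := by
        rw [abs_mul, abs_mul, abs_of_nonneg hp0, abs_of_nonneg ha0]
        have := mul_le_mul_of_nonneg_left h2 ha0
        nlinarith [abs_nonneg (Real.exp (-a) - 1 - -a)]

theorem sum_setIntegral_fiber {Ω ι : Type*} [MeasurableSpace Ω] {P : Measure Ω} [Fintype ι]
    [MeasurableSpace ι] [MeasurableSingletonClass ι] {X : Ω → ι} (hX : Measurable X) {f : Ω → ℝ}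
    (hf : Integrable f P) {B : Set Ω} (hB : MeasurableSet B) :
    ∑ k, ∫ ω in X ⁻¹' {k} ∩ B, f ω ∂P = ∫ ω in B, f ω ∂P := by
  rw [← integral_iUnion_fintype (fun k => (hX (measurableSet_singleton k)).inter hB)]
  · congr 2
    ext ω
    simp
  · intro i j hij
    refine (Disjoint.preimage X (disjoint_singleton.2 hij)).mono inter_subset_left inter_subset_left
  · exact fun i => hf.integrableOn

/-! ### The Markov property and the one-step expansion -/

namespace IsMarkovChainWithRates

variable {Ω : Type*} [MeasurableSpace Ω] {P : Measure Ω} {r : ℕ} {q : Fin r → Fin r → ℝ}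
  {M : ℝ → Ω → Fin r}

theorem measurableSet_fiber (hM : IsMarkovChainWithRates P q M) {v : ℝ} (hv : 0 ≤ v) (k : Fin r) :
    MeasurableSet (M v ⁻¹' {k}) :=
  hM.measurable v hv (measurableSet_singleton k)

/-- The Markov property passes from events to functionals of the past: under the conditional measure
`Y` is independent of the indicator of the future event, so the expectation of the product factors.
-/
theorem setIntegral_inter [IsProbabilityMeasure P] (hM : IsMarkovChainWithRates P q M) {v h : ℝ}
    (hv : 0 ≤ v) (hh : 0 ≤ h) (k j : Fin r) {Y : Ω → ℝ}
    (hY : AEStronglyMeasurable[sigmaOf M (Icc 0 v)] Y P) :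
    ∫ ω in M v ⁻¹' {k} ∩ M (v + h) ⁻¹' {j}, Y ω ∂P =
      (∫ ω in M v ⁻¹' {k}, Y ω ∂P) * (P[|M v ⁻¹' {k}]).real (M (v + h) ⁻¹' {j}) := by
  have hA := hM.measurableSet_fiber hv k
  have hB := hM.measurableSet_fiber (add_nonneg hv hh) j
  by_cases h0 : P (M v ⁻¹' {k}) = 0
  · rw [Measure.restrict_eq_zero.2 h0,
      Measure.restrict_eq_zero.2 (measure_mono_null inter_subset_left h0)]
    simp
  have hind := hM.markov v h hv hh k h0
  set A := M v ⁻¹' {k}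
  set B := M (v + h) ⁻¹' {j}
  obtain ⟨Z, hZ, hYZ⟩ := hY
  rw [setIntegral_congr_ae (g := Z) (hA.inter hB) (hYZ.mono fun ω h _ => h),
    setIntegral_congr_ae (g := Z) hA (hYZ.mono fun ω h _ => h)]
  have hcond : ∀ f : Ω → ℝ, ∫ ω, f ω ∂P[|A] = (P A)⁻¹.toReal * ∫ ω in A, f ω ∂P := by
    intro f
    rw [ProbabilityTheory.cond, integral_smul_measure, smul_eq_mul]
  have hBm : Measurable[sigmaOf M {v + h}] (B.indicator fun _ => (1 : ℝ)) := by
    refine @Measurable.indicator _ _ (_) _ _ _ _ (@measurable_const _ _ _ (_) _) ?_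
    exact measurable_sigmaOf M (mem_singleton _) (measurableSet_singleton j)
  have hi : IndepFun Z (B.indicator fun _ => (1 : ℝ)) P[|A] := by
    rw [IndepFun_iff_Indep]
    exact indep_of_indep_of_le_left (indep_of_indep_of_le_right hind hBm.comap_le)
      hZ.measurable.comap_le
  have hZ' : AEStronglyMeasurable Z P[|A] :=
    (hZ.mono (hM.sigmaOf_Icc_le v)).aestronglyMeasurable
  have h1 := hi.integral_fun_mul_eq_mul_integral hZ'
    ((measurable_const.indicator hB).aestronglyMeasurable)
  rw [integral_indicator_const _ hB, smul_eq_mul, mul_one, hcond, hcond] at h1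
  have h2 : ∀ ω, Z ω * B.indicator (fun _ => (1 : ℝ)) ω = B.indicator Z ω := by
    intro ω
    by_cases hω : ω ∈ B <;> simp [hω]
  simp_rw [h2] at h1
  rw [setIntegral_indicator hB, mul_assoc] at h1
  refine mul_left_cancel₀ ?_ h1
  simp [ENNReal.toReal_eq_zero_iff, h0]

/-- First-order expansion of the transition probabilities, uniform in the starting time. -/
theorem eventually_abs_transition_sub_le [IsProbabilityMeasure P]
    (hM : IsMarkovChainWithRates P q M) (k j : Fin r) {ε : ℝ} (hε : 0 < ε) :
    ∀ᶠ h in 𝓝[>] (0 : ℝ), ∀ v, 0 ≤ v → P (M v ⁻¹' {k}) ≠ 0 →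
      |(P[|M v ⁻¹' {k}]).real (M (v + h) ⁻¹' {j}) - (1 : Matrix (Fin r) (Fin r) ℝ) k j -
        rateMatrix q k j * h| ≤ ε * h := by
  have key : ∀ j', k ≠ j' → ∀ ε : ℝ, 0 < ε → ∀ᶠ h in 𝓝[>] (0 : ℝ), ∀ v, 0 ≤ v →
      P (M v ⁻¹' {k}) ≠ 0 →
      |(P[|M v ⁻¹' {k}]).real (M (v + h) ⁻¹' {j'}) - q k j' * h| ≤ ε * h := by
    intro j' hj' ε hε
    obtain ⟨δ, hδ, H⟩ := hM.intensity k j' hj' ε hε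
    filter_upwards [Ioo_mem_nhdsGT hδ] with h hh v hv h0
    exact H v h hv hh.1 hh.2 h0
  by_cases hkj : k = j
  · subst hkj
    -- The row of transition probabilities sums to one, so the diagonal error is minus the sum of
    -- the off-diagonal errors; there are fewer than `r + 1` of them.
    have h1 : ∀ᶠ h in 𝓝[>] (0 : ℝ), ∀ j' ∈ Finset.univ.erase k, ∀ v, 0 ≤ v →
        P (M v ⁻¹' {k}) ≠ 0 →
        |(P[|M v ⁻¹' {k}]).real (M (v + h) ⁻¹' {j'}) - q k j' * h| ≤ ε / (r + 1) * h :=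
      (Filter.eventually_all_finset _).2 fun j' hj' =>
        key j' (Finset.ne_of_mem_erase hj').symm _ (by positivity)
    filter_upwards [h1, self_mem_nhdsWithin] with h hh hpos v hv h0
    rw [mem_Ioi] at hpos
    have := cond_isProbabilityMeasure h0
    have hs := sum_measureReal_preimage_singleton (μ := P[|M v ⁻¹' {k}]) Finset.univ
      (f := M (v + h)) (fun y _ => hM.measurableSet_fiber (by positivity) y)
    rw [Finset.coe_univ, preimage_univ, probReal_univ,
      ← Finset.add_sum_erase _ _ (Finset.mem_univ k)] at hs
    have h2 : |∑ j' ∈ Finset.univ.erase k,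
        ((P[|M v ⁻¹' {k}]).real (M (v + h) ⁻¹' {j'}) - q k j' * h)| ≤ ε * h := by
      refine (Finset.abs_sum_le_sum_abs _ _).trans
        ((Finset.sum_le_sum fun j' hj' => hh j' hj' v hv h0).trans ?_)
      rw [Finset.sum_const, nsmul_eq_mul]
      have : ((Finset.univ.erase k).card : ℝ) ≤ r + 1 := by
        have := Finset.card_le_univ (Finset.univ.erase k)
        rw [Fintype.card_fin] at this
        exact_mod_cast this.trans (Nat.le_succ r)
      calc _ ≤ (r + 1 : ℝ) * (ε / (r + 1) * h) := by gcongr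
        _ = ε * h := by field_simp
    rw [Finset.sum_sub_distrib, ← Finset.sum_mul] at h2
    rw [← abs_neg] at h2
    convert h2 using 2
    simp only [rateMatrix, Matrix.of_apply, if_true, Matrix.one_apply_eq]
    linarith
  · filter_upwards [key j hkj ε hε] with h hh v hv h0
    simpa [Matrix.one_apply_ne hkj, rateMatrix, hkj] using hh v hv h0

/-- Only the state at the single time `u` matters, not whether the chain left `k` in between; Fubini
needs no more. The constant is the diagonal expansion with `ε = 1`, whose validity for all steps
below `δ` covers every `u - v ≤ h`. -/
theorem eventually_measureReal_leave_le [IsProbabilityMeasure P]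
    (hM : IsMarkovChainWithRates P q M) (k : Fin r) :
    ∀ᶠ h in 𝓝[>] (0 : ℝ), ∀ v u, 0 ≤ v → v < u → u ≤ v + h →
      P.real (M v ⁻¹' {k} ∩ M u ⁻¹' {k}ᶜ) ≤ (1 + |rateMatrix q k k|) * h := by
  obtain ⟨δ, hδ, H⟩ := mem_nhdsGT_iff_exists_Ioo_subset.1
    (hM.eventually_abs_transition_sub_le k k one_pos)
  filter_upwards [Ioo_mem_nhdsGT hδ] with h hh v u hv hvu huh
  have hpos : 0 < h := hh.1
  by_cases h0 : P (M v ⁻¹' {k}) = 0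
  · rw [measureReal_def, measure_mono_null inter_subset_left h0]
    simpa using by positivity
  have h1 := H (show u - v ∈ Ioo 0 δ from ⟨by linarith, by linarith [hh.2]⟩) v hv h0
  rw [add_sub_cancel, Matrix.one_apply_eq] at h1
  have := cond_isProbabilityMeasure h0
  have h2 := probReal_compl_eq_one_sub (μ := P[|M v ⁻¹' {k}])
    (hM.measurableSet_fiber (hv.trans hvu.le) k)
  have h3 : P.real (M v ⁻¹' {k} ∩ M u ⁻¹' {k}ᶜ) ≤
      (P[|M v ⁻¹' {k}]).real (M u ⁻¹' {k})ᶜ := by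
    rw [measureReal_def, ← cond_mul_eq_inter (hM.measurableSet_fiber hv k), ENNReal.toReal_mul]
    exact mul_le_of_le_one_right measureReal_nonneg measureReal_le_one
  have h4 := (abs_le.1 h1).1
  have h5 : -rateMatrix q k k * (u - v) ≤ |rateMatrix q k k| * (u - v) :=
    mul_le_mul_of_nonneg_right (neg_le_abs _) (by linarith)
  have h6 : (1 + |rateMatrix q k k|) * (u - v) ≤ (1 + |rateMatrix q k k|) * h := by
    gcongr
    linarith
  nlinarith

/-- By Fubini, the left side is at most the time integral of the expectation of `|κ (M u) - κ k|` on
`{M v = k}`, and that integrand vanishes where `M u = k`. With `c = O(h)` the bound is `O(h ^ 2)`.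
-/
theorem setIntegral_abs_cumulativeIntensity_sub_le [IsProbabilityMeasure P]
    (hM : IsMarkovChainWithRates P q M) (κ : Fin r → ℝ) (k : Fin r) {v h c L : ℝ} (hv : 0 ≤ v)
    (hh : 0 ≤ h) (hL : ∀ i, |κ i - κ k| ≤ L)
    (hc : ∀ u ∈ Ioc v (v + h), P.real (M v ⁻¹' {k} ∩ M u ⁻¹' {k}ᶜ) ≤ c) :
    ∫ ω in M v ⁻¹' {k}, |cumulativeIntensity κ (fun _ => 1) M v (v + h) ω - κ k * h| ∂P ≤
      L * c * h := by
  have hvh : v ≤ v + h := by linarith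
  have hL0 : 0 ≤ L := (abs_nonneg _).trans (hL k)
  have hA := hM.measurableSet_fiber hv k
  set A := M v ⁻¹' {k}
  let G : Ω → ℝ → ℝ := fun ω u => |κ (M u ω) - κ k|
  have hG : AEStronglyMeasurable (Function.uncurry G)
      ((P.restrict A).prod (volume.restrict (Ioc v (v + h)))) :=
    ((hM.aemeasurable_prod (fun i => |κ i - κ k|) hv hvh).mono_ac
      (Measure.restrict_le_self.absolutelyContinuous.prod .rfl)).aestronglyMeasurable
  have hGi : Integrable (Function.uncurry G)
      ((P.restrict A).prod (volume.restrict (Ioc v (v + h)))) :=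
    Integrable.of_bound hG L (Eventually.of_forall fun p => by
      simpa [G, Function.uncurry] using hL (M p.2 p.1))
  have h1 : ∫ ω in A, |cumulativeIntensity κ (fun _ => 1) M v (v + h) ω - κ k * h| ∂P ≤
      ∫ ω in A, (∫ u in Ioc v (v + h), G ω u) ∂P := by
    refine integral_mono_of_nonneg (Eventually.of_forall fun _ => abs_nonneg _)
      hGi.integral_prod_left ?_
    refine ae_restrict_of_ae ?_
    filter_upwards [hM.ae_intervalIntegrable κ] with ω hω
    have h2 : cumulativeIntensity κ (fun _ => 1) M v (v + h) ω - κ k * h =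
        ∫ u in v..(v + h), (κ (M u ω) - κ k) := by
      rw [intervalIntegral.integral_sub (hω v _ hv hvh) intervalIntegrable_const]
      simp [cumulativeIntensity, mul_comm]
    simp only [h2]
    refine (intervalIntegral.abs_integral_le_integral_abs hvh).trans_eq ?_
    rw [intervalIntegral.integral_of_le hvh]
  refine h1.trans ?_
  rw [integral_integral_swap hGi]
  have h3 : ∀ u ∈ Ioc v (v + h), ∫ ω in A, G ω u ∂P ≤ L * c := by
    intro u hu
    have hB : MeasurableSet (M u ⁻¹' {k}ᶜ) := (hM.measurableSet_fiber (hv.trans hu.1.le) k).compl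
    calc ∫ ω in A, G ω u ∂P ≤ ∫ ω in A, (M u ⁻¹' {k}ᶜ).indicator (fun _ => L) ω ∂P := by
          refine integral_mono_of_nonneg (Eventually.of_forall fun _ => abs_nonneg _)
            ((integrable_const L).indicator hB) (Eventually.of_forall fun ω => ?_)
          by_cases hω : M u ω = k
          · simp [G, hω]
          · simpa [G, hω] using hL (M u ω)
      _ = P.real (A ∩ M u ⁻¹' {k}ᶜ) * L := by
          rw [setIntegral_indicator hB, setIntegral_const, smul_eq_mul]
      _ ≤ L * c := by
          rw [mul_comm]
          exact mul_le_mul_of_nonneg_left (hc u hu) hL0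
  refine (setIntegral_mono_on hGi.integral_prod_right (integrable_const (L * c))
    measurableSet_Ioc h3).trans_eq ?_
  simp [hh, mul_comm]

end IsMarkovChainWithRates

theorem cumulativeIntensity_nonneg {Ω : Type*} {r : ℕ} {lam : Fin r → ℝ} (hlam : ∀ i, 0 ≤ lam i)
    {γ : ℝ → ℝ} (hγ : ∀ u, 0 ≤ u → 0 ≤ γ u) (M : ℝ → Ω → Fin r) {a b : ℝ} (ha : 0 ≤ a)
    (hab : a ≤ b) (ω : Ω) : 0 ≤ cumulativeIntensity lam γ M a b ω :=
  intervalIntegral.integral_nonneg hab fun u hu => mul_nonneg (hlam _) (hγ u (ha.trans hu.1))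

namespace IsMarkovChainWithRates

variable {Ω : Type*} [MeasurableSpace Ω] {P : Measure Ω} {r : ℕ} {q : Fin r → Fin r → ℝ}
  {M : ℝ → Ω → Fin r}

theorem aestronglyMeasurable_exp_neg_cumulativeIntensity (hM : IsMarkovChainWithRates P q M)
    (κ : Fin r → ℝ) {a b : ℝ} (ha : 0 ≤ a) (hab : a ≤ b) :
    AEStronglyMeasurable[sigmaOf M (Icc 0 b)]
      (fun ω => Real.exp (-cumulativeIntensity κ (fun _ => 1) M a b ω)) P :=
  (Real.continuous_exp.comp continuous_neg).comp_aestronglyMeasurable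
    (hM.aestronglyMeasurable_cumulativeIntensity κ ha hab intervalIntegrable_const)

/-- The step size is chosen before `v` and `Y`. This uniformity allows `Y` to be the exponential
weight accumulated up to time `v`. -/
theorem eventually_abs_setIntegral_inter_sub_le [IsProbabilityMeasure P]
    (hM : IsMarkovChainWithRates P q M) {κ : Fin r → ℝ} (hκ : ∀ i, 0 ≤ κ i) (k j : Fin r)
    {ε : ℝ} (hε : 0 < ε) :
    ∀ᶠ h in 𝓝[>] (0 : ℝ), ∀ v, 0 ≤ v → ∀ Y : Ω → ℝ,
      AEStronglyMeasurable[sigmaOf M (Icc 0 v)] Y P → (∀ᵐ ω ∂P, |Y ω| ≤ 1) →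
      |∫ ω in M v ⁻¹' {k} ∩ M (v + h) ⁻¹' {j},
          Y ω * Real.exp (-cumulativeIntensity κ (fun _ => 1) M v (v + h) ω) ∂P -
        (∫ ω in M v ⁻¹' {k}, Y ω ∂P) *
          ((1 : Matrix (Fin r) (Fin r) ℝ) k j + h * (rateMatrix q - Matrix.diagonal κ) k j)| ≤
        ε * h := by
  obtain ⟨L, hL⟩ := (Set.finite_range fun i => |κ i - κ k|).bddAbove
  replace hL : ∀ i, |κ i - κ k| ≤ L := fun i => hL ⟨i, rfl⟩
  have hL0 : 0 ≤ L := (abs_nonneg _).trans (hL k)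
  have hκk := hκ k
  -- `W` is the coefficient of `h ^ 2` in the sum of the errors `e1` and `e2` below; the remaining
  -- term is `ε / 2 * h`, so `h * W ≤ ε / 2` suffices.
  set W := L * (1 + |rateMatrix q k k|) + κ k ^ 2 + κ k * (ε / 2 + |rateMatrix q k j|) with hW
  have hW0 : 0 ≤ W := by positivity
  have hs1 : Ioo 0 (ε / 2 / (W + 1)) ∈ 𝓝[>] (0 : ℝ) := Ioo_mem_nhdsGT (by positivity)
  -- This forces `κ k * h ≤ 1`, as the quadratic bound on the exponential requires.
  have hs2 : Ioo 0 (1 / (κ k + 1)) ∈ 𝓝[>] (0 : ℝ) := Ioo_mem_nhdsGT (by positivity)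
  filter_upwards [hM.eventually_abs_transition_sub_le k j (half_pos hε),
    hM.eventually_measureReal_leave_le k, hs1, hs2] with h hp hleave hh1 hh2 v hv Y hY hY1
  have hpos : 0 < h := hh1.1
  have hvh : v ≤ v + h := by linarith
  have hA := hM.measurableSet_fiber hv k
  have hB := hM.measurableSet_fiber (hv.trans hvh) j
  set A := M v ⁻¹' {k} with hAdef
  set B := M (v + h) ⁻¹' {j} with hBdef
  let C : Ω → ℝ := fun ω => cumulativeIntensity κ (fun _ => 1) M v (v + h) ω
  have hC0 : ∀ ω, 0 ≤ C ω := cumulativeIntensity_nonneg hκ (fun _ _ => zero_le_one) M hv hvh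
  have hCm : AEStronglyMeasurable C P :=
    (hM.aestronglyMeasurable_cumulativeIntensity κ hv hvh intervalIntegrable_const).mono
      (hM.sigmaOf_Icc_le _)
  have hEm : AEStronglyMeasurable (fun ω => Real.exp (-C ω)) P :=
    (hM.aestronglyMeasurable_exp_neg_cumulativeIntensity κ hv hvh).mono (hM.sigmaOf_Icc_le _)
  have hYm : AEStronglyMeasurable Y P := hY.mono (hM.sigmaOf_Icc_le _)
  have hYi : Integrable Y P := Integrable.of_bound hYm 1 hY1
  have hYE : Integrable (fun ω => Y ω * Real.exp (-C ω)) P := by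
    refine Integrable.of_bound (hYm.mul hEm) 1 ?_
    filter_upwards [hY1] with ω hω
    rw [Real.norm_eq_abs, abs_mul, Real.abs_exp]
    exact mul_le_one₀ hω (Real.exp_pos _).le (Real.exp_le_one_iff.2 (neg_nonpos.2 (hC0 ω)))
  have hCi : Integrable (fun ω => |C ω - κ k * h|) P := by
    obtain ⟨R, hR⟩ := (Set.finite_range fun i => |κ i|).bddAbove
    have hCi : Integrable C P := by
      refine Integrable.of_bound hCm (R * |v + h - v|) (Eventually.of_forall fun ω => ?_)
      exact intervalIntegral.norm_integral_le_of_norm_le_const fun u _ => by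
        simpa using hR ⟨M u ω, rfl⟩
    exact (hCi.sub (integrable_const _)).abs
  have e1 : |∫ ω in A ∩ B, Y ω * Real.exp (-C ω) ∂P -
      (∫ ω in A ∩ B, Y ω ∂P) * Real.exp (-(κ k * h))| ≤
      L * ((1 + |rateMatrix q k k|) * h) * h := by
    rw [← integral_mul_const, ← integral_sub hYE.integrableOn (hYi.mul_const _).integrableOn]
    calc _ ≤ ∫ ω in A ∩ B, |C ω - κ k * h| ∂P := by
          rw [← Real.norm_eq_abs]
          refine norm_integral_le_of_norm_le hCi.integrableOn (ae_restrict_of_ae ?_)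
          filter_upwards [hY1] with ω hω
          rw [← mul_sub, Real.norm_eq_abs, abs_mul]
          calc _ ≤ 1 * |C ω - κ k * h| := by
                exact mul_le_mul hω (abs_exp_neg_sub_exp_neg_le (hC0 ω) (by positivity))
                  (abs_nonneg _) zero_le_one
            _ = _ := one_mul _
      _ ≤ ∫ ω in A, |C ω - κ k * h| ∂P :=
          setIntegral_mono_set hCi.integrableOn (Eventually.of_forall fun _ => abs_nonneg _)
            (Eventually.of_forall inter_subset_left)
      _ ≤ _ := hM.setIntegral_abs_cumulativeIntensity_sub_le κ k hv hpos.le hL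
          fun u hu => hleave v u hv hu.1 hu.2
  have hYA : |∫ ω in A, Y ω ∂P| ≤ 1 := by
    have := norm_setIntegral_le_of_norm_le_const_ae (μ := P) (s := A) (f := Y) (C := 1)
      (measure_lt_top _ _) (ae_restrict_of_ae hY1)
    exact this.trans (by rw [one_mul]; exact measureReal_le_one)
  have e2 : |(∫ ω in A ∩ B, Y ω ∂P) * Real.exp (-(κ k * h)) - (∫ ω in A, Y ω ∂P) *
      ((1 : Matrix (Fin r) (Fin r) ℝ) k j + h * (rateMatrix q - Matrix.diagonal κ) k j)| ≤
      (κ k * h) ^ 2 + ε / 2 * h + κ k * h * (ε / 2 * h + |rateMatrix q k j * h|) := by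
    rw [hM.setIntegral_inter hv hpos.le k j hY]
    by_cases h0 : P A = 0
    · rw [Measure.restrict_eq_zero.2 h0]
      simp only [integral_zero_measure, zero_mul, sub_zero, abs_zero]
      positivity
    have := cond_isProbabilityMeasure h0
    have h1 := abs_mul_exp_neg_sub_le (p := (P[|A]).real B) (a := κ k * h) measureReal_nonneg
      measureReal_le_one (by positivity)
      (by have := hh2.2; rw [lt_div_iff₀ (by positivity)] at this; nlinarith) (hp v hv h0)
    have h2 : (1 : Matrix (Fin r) (Fin r) ℝ) k j + h * (rateMatrix q - Matrix.diagonal κ) k j =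
        (1 : Matrix (Fin r) (Fin r) ℝ) k j +
          (rateMatrix q k j * h - κ k * h * (1 : Matrix (Fin r) (Fin r) ℝ) k j) := by
      rw [Matrix.sub_apply, Matrix.diagonal_apply, Matrix.one_apply]
      split_ifs <;> ring
    rw [h2, mul_assoc, ← mul_sub, abs_mul]
    exact (mul_le_of_le_one_left (abs_nonneg _) hYA).trans h1
  refine (abs_sub_le _ _ _).trans ((add_le_add e1 e2).trans ?_)
  have h3 : h * W ≤ ε / 2 := by
    have := hh1.2
    rw [lt_div_iff₀ (by positivity)] at this
    nlinarith
  rw [abs_mul, abs_of_pos hpos]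
  have h4 := mul_le_mul_of_nonneg_right h3 hpos.le
  rw [hW] at h4
  linarith

theorem eventually_abs_setIntegral_sub_le [IsProbabilityMeasure P]
    (hM : IsMarkovChainWithRates P q M) {κ : Fin r → ℝ} (hκ : ∀ i, 0 ≤ κ i) (j : Fin r)
    {ε : ℝ} (hε : 0 < ε) :
    ∀ᶠ h in 𝓝[>] (0 : ℝ), ∀ v, 0 ≤ v → ∀ Y : Ω → ℝ,
      AEStronglyMeasurable[sigmaOf M (Icc 0 v)] Y P → (∀ᵐ ω ∂P, |Y ω| ≤ 1) →
      |∫ ω in M (v + h) ⁻¹' {j},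
          Y ω * Real.exp (-cumulativeIntensity κ (fun _ => 1) M v (v + h) ω) ∂P -
        ∑ k, (∫ ω in M v ⁻¹' {k}, Y ω ∂P) *
          ((1 : Matrix (Fin r) (Fin r) ℝ) k j + h * (rateMatrix q - Matrix.diagonal κ) k j)| ≤
        ε * h := by
  have h1 := Filter.eventually_all.2 fun k =>
    hM.eventually_abs_setIntegral_inter_sub_le hκ k j (ε := ε / (r + 1)) (by positivity)
  filter_upwards [h1, self_mem_nhdsWithin] with h hh hpos v hv Y hY hY1
  rw [mem_Ioi] at hpos
  have hvh : v ≤ v + h := by linarith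
  have hYE : Integrable (fun ω => Y ω *
      Real.exp (-cumulativeIntensity κ (fun _ => 1) M v (v + h) ω)) P := by
    refine Integrable.of_bound ((hY.mono (hM.sigmaOf_Icc_le _)).mul
      ((hM.aestronglyMeasurable_exp_neg_cumulativeIntensity κ hv hvh).mono
        (hM.sigmaOf_Icc_le _))) 1 ?_
    filter_upwards [hY1] with ω hω
    rw [Real.norm_eq_abs, abs_mul, Real.abs_exp]
    exact mul_le_one₀ hω (Real.exp_pos _).le (Real.exp_le_one_iff.2 (neg_nonpos.2
      (cumulativeIntensity_nonneg hκ (fun _ _ => zero_le_one) M hv hvh ω)))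
  rw [← sum_setIntegral_fiber (hM.measurable v hv) hYE
    (hM.measurableSet_fiber (hv.trans hvh) j), ← Finset.sum_sub_distrib]
  refine (Finset.abs_sum_le_sum_abs _ _).trans
    ((Finset.sum_le_sum fun k _ => hh k v hv Y hY hY1).trans ?_)
  rw [Finset.sum_const, nsmul_eq_mul, Finset.card_univ, Fintype.card_fin]
  calc (r : ℝ) * (ε / (r + 1) * h) ≤ (r + 1 : ℝ) * (ε / (r + 1) * h) := by gcongr; linarith
    _ = ε * h := by field_simp

end IsMarkovChainWithRates

/-! ### The linear ODE solved by the matrix exponential -/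

open scoped Matrix.Norms.Operator in
theorem hasDerivAt_vecMul_exp_smul {ι : Type*} [Fintype ι] [DecidableEq ι] (x : ι → ℝ)
    (A : Matrix ι ι ℝ) (s : ℝ) :
    HasDerivAt (fun s : ℝ => Matrix.vecMul x (NormedSpace.exp (s • A)))
      (Matrix.vecMul (Matrix.vecMul x (NormedSpace.exp (s • A))) A) s := by
  let T : Matrix ι ι ℝ →ₗ[ℝ] (ι → ℝ) :=
    { toFun := fun B => Matrix.vecMul x B
      map_add' := fun B C => Matrix.vecMul_add B C x
      map_smul' := fun c B => Matrix.vecMul_smul x c B }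
  have h := (LinearMap.toContinuousLinearMap T).hasFDerivAt.comp_hasDerivAt s
    (hasDerivAt_exp_smul_const A s)
  rw [Matrix.vecMul_vecMul]
  exact h

/-- A bounded curve whose increments satisfy `u (s + h) = u s + h • (u s ᵥ* A) + o(h)` uniformly in
`s` as `h ↓ 0` is given by the matrix exponential. -/
theorem eq_vecMul_exp_of_eventually_abs_sub_le {ι : Type*} [Fintype ι] [DecidableEq ι]
    {u : ℝ → ι → ℝ} {A : Matrix ι ι ℝ} (hu : ∀ s, 0 ≤ s → ∀ j, |u s j| ≤ 1)
    (hA : ∀ j, ∀ ε : ℝ, 0 < ε → ∀ᶠ h in 𝓝[>] (0 : ℝ), ∀ s, 0 ≤ s →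
      |u (s + h) j - u s j - h * Matrix.vecMul (u s) A j| ≤ ε * h) {s : ℝ} (hs : 0 ≤ s) :
    u s = Matrix.vecMul (u 0) (NormedSpace.exp (s • A)) := by
  have hcont : ContinuousOn u (Icc 0 s) := by
    refine continuousOn_pi.2 fun j => ?_
    obtain ⟨δ, hδ, H⟩ := mem_nhdsGT_iff_exists_Ioo_subset.1 (hA j 1 one_pos)
    have hK : ∀ x, 0 ≤ x → |Matrix.vecMul (u x) A j| ≤ ∑ i, |A i j| := by
      intro x hx
      refine (Finset.abs_sum_le_sum_abs _ _).trans (Finset.sum_le_sum fun i _ => ?_)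
      rw [abs_mul]
      exact mul_le_of_le_one_left (abs_nonneg _) (hu x hx i)
    set K := 1 + ∑ i, |A i j| with hKdef
    have hK0 : 0 < K := by positivity
    -- Since `δ` does not depend on the base point, this estimate also controls increments to the
    -- left of a point, by basing it at the left endpoint. Right expansions thus yield two-sided
    -- continuity.
    have h1 : ∀ x y, 0 ≤ x → x < y → y < x + δ → |u y j - u x j| ≤ K * (y - x) := by
      intro x y hx hxy hyx
      have h2 := H (show y - x ∈ Ioo 0 δ from ⟨by linarith, by linarith⟩) x hx
      rw [add_sub_cancel] at h2
      calc |u y j - u x j| = |(u y j - u x j - (y - x) * Matrix.vecMul (u x) A j) +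
            (y - x) * Matrix.vecMul (u x) A j| := by ring_nf
        _ ≤ 1 * (y - x) + (y - x) * ∑ i, |A i j| := by
            refine (abs_add_le _ _).trans (add_le_add h2 ?_)
            rw [abs_mul, abs_of_pos (sub_pos.2 hxy)]
            exact mul_le_mul_of_nonneg_left (hK x hx) (sub_pos.2 hxy).le
        _ = _ := by rw [hKdef]; ring
    rw [Metric.continuousOn_iff]
    intro x hx ε hε
    refine ⟨min δ (ε / K), lt_min hδ (by positivity), fun y hy hyx => ?_⟩
    rw [Real.dist_eq] at hyx ⊢
    have h3 : |u y j - u x j| ≤ K * |y - x| := by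
      have hyδ := abs_lt.1 (hyx.trans_le (min_le_left _ _))
      rcases lt_trichotomy x y with h | h | h
      · rw [abs_of_pos (sub_pos.2 h)]
        exact h1 x y hx.1 h (by linarith)
      · simp [h]
      · rw [abs_sub_comm, abs_sub_comm y, abs_of_pos (sub_pos.2 h)]
        exact h1 y x hy.1 h (by linarith)
    refine h3.trans_lt ?_
    have := hyx.trans_le (min_le_right _ _)
    rwa [lt_div_iff₀ hK0, mul_comm] at this
  have hderiv : ∀ x, 0 ≤ x → HasDerivWithinAt u (Matrix.vecMul (u x) A) (Ici x) x := by
    intro x hx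
    refine hasDerivWithinAt_pi.2 fun j => ?_
    rw [← hasDerivWithinAt_Ioi_iff_Ici, hasDerivWithinAt_iff_isLittleO, Asymptotics.isLittleO_iff]
    intro c hc
    obtain ⟨δ, hδ, H⟩ := mem_nhdsGT_iff_exists_Ioo_subset.1 (hA j c hc)
    have hδ' : x < x + δ := by linarith [mem_Ioi.1 hδ]
    filter_upwards [Ioo_mem_nhdsGT hδ'] with y hy
    have h2 := H (show y - x ∈ Ioo 0 δ from ⟨by linarith [hy.1], by linarith [hy.2]⟩) x hx
    rw [add_sub_cancel] at h2
    rwa [Real.norm_eq_abs, Real.norm_eq_abs, abs_of_pos (sub_pos.2 hy.1), smul_eq_mul]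
  let T : (ι → ℝ) →L[ℝ] (ι → ℝ) := LinearMap.toContinuousLinearMap (Matrix.vecMulLinear A)
  refine ODE_solution_unique (v := fun _ x => Matrix.vecMul x A) (K := ‖T‖₊) (fun _ => T.lipschitz)
    hcont (fun x hx => hderiv x hx.1)
    (g := fun s => Matrix.vecMul (u 0) (NormedSpace.exp (s • A)))
    (fun x _ => (hasDerivAt_vecMul_exp_smul _ A x).continuousAt.continuousWithinAt)
    (fun x _ => (hasDerivAt_vecMul_exp_smul _ A x).hasDerivWithinAt) ?_ ⟨hs, le_rfl⟩
  simp [NormedSpace.exp_zero]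

/-! ### The Feynman–Kac formula -/

namespace IsMarkovChainWithRates

variable {Ω : Type*} [MeasurableSpace Ω] {P : Measure Ω} {r : ℕ} {q : Fin r → Fin r → ℝ}
  {M : ℝ → Ω → Fin r}

/-- The Feynman–Kac formula for a finite-state chain killed at rate `κ`. -/
theorem setIntegral_exp_neg_cumulativeIntensity [IsProbabilityMeasure P]
    (hM : IsMarkovChainWithRates P q M) {κ : Fin r → ℝ} (hκ : ∀ i, 0 ≤ κ i) {t : ℝ} (ht : 0 ≤ t)
    {X : Ω → ℝ} (hX : AEStronglyMeasurable[sigmaOf M (Icc 0 t)] X P)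
    (hX1 : ∀ᵐ ω ∂P, |X ω| ≤ 1) {s : ℝ} (hs : 0 ≤ s) (j : Fin r) :
    ∫ ω in M (t + s) ⁻¹' {j},
        X ω * Real.exp (-cumulativeIntensity κ (fun _ => 1) M t (t + s) ω) ∂P =
      Matrix.vecMul (fun i => ∫ ω in M t ⁻¹' {i}, X ω ∂P)
        (NormedSpace.exp (s • (rateMatrix q - Matrix.diagonal κ))) j := by
  let Y : ℝ → Ω → ℝ := fun s ω =>
    X ω * Real.exp (-cumulativeIntensity κ (fun _ => 1) M t (t + s) ω)
  let u : ℝ → Fin r → ℝ := fun s j => ∫ ω in M (t + s) ⁻¹' {j}, Y s ω ∂P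
  have hYm : ∀ s, 0 ≤ s → AEStronglyMeasurable[sigmaOf M (Icc 0 (t + s))] (Y s) P := fun s hs =>
    (hX.mono (sigmaOf_mono M (Icc_subset_Icc_right (by linarith)))).mul
      (hM.aestronglyMeasurable_exp_neg_cumulativeIntensity κ ht (by linarith))
  have hY1 : ∀ s, 0 ≤ s → ∀ᵐ ω ∂P, |Y s ω| ≤ 1 := by
    intro s hs
    filter_upwards [hX1] with ω hω
    rw [abs_mul, Real.abs_exp]
    exact mul_le_one₀ hω (Real.exp_pos _).le (Real.exp_le_one_iff.2 (neg_nonpos.2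
      (cumulativeIntensity_nonneg hκ (fun _ _ => zero_le_one) M ht (by linarith) ω)))
  have hu : ∀ s, 0 ≤ s → ∀ j, |u s j| ≤ 1 := by
    intro s hs j
    have := norm_setIntegral_le_of_norm_le_const_ae (μ := P) (s := M (t + s) ⁻¹' {j}) (f := Y s)
      (C := 1) (measure_lt_top _ _) (ae_restrict_of_ae (hY1 s hs))
    exact this.trans (by rw [one_mul]; exact measureReal_le_one)
  have hstep : ∀ j, ∀ ε : ℝ, 0 < ε → ∀ᶠ h in 𝓝[>] (0 : ℝ), ∀ s, 0 ≤ s →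
      |u (s + h) j - u s j - h * Matrix.vecMul (u s) (rateMatrix q - Matrix.diagonal κ) j| ≤
        ε * h := by
    intro j ε hε
    filter_upwards [hM.eventually_abs_setIntegral_sub_le hκ j hε, self_mem_nhdsWithin]
      with h hh hpos s hs
    rw [mem_Ioi] at hpos
    -- The accumulated weight `Y s` is a functional of the past up to `t + s`, bounded by one, so
    -- the one-step expansion applies to it.
    have h1 := hh (t + s) (add_nonneg ht hs) (Y s) (hYm s hs) (hY1 s hs)
    have h2 : ∫ ω in M (t + s + h) ⁻¹' {j}, Y s ω *
        Real.exp (-cumulativeIntensity κ (fun _ => 1) M (t + s) (t + s + h) ω) ∂P =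
        u (s + h) j := by
      rw [add_assoc]
      refine integral_congr_ae (ae_restrict_of_ae ?_)
      filter_upwards [hM.ae_intervalIntegrable κ] with ω hω
      have h3 : cumulativeIntensity κ (fun _ => 1) M t (t + (s + h)) ω =
          cumulativeIntensity κ (fun _ => 1) M t (t + s) ω +
            cumulativeIntensity κ (fun _ => 1) M (t + s) (t + (s + h)) ω := by
        simp only [cumulativeIntensity, mul_one]
        exact (intervalIntegral.integral_add_adjacent_intervals (hω _ _ ht (by linarith))
          (hω _ _ (by linarith) (by linarith))).symm
      simp only [Y]
      rw [h3, neg_add, Real.exp_add, mul_assoc]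
    have h4 : ∑ k, u s k * ((1 : Matrix (Fin r) (Fin r) ℝ) k j +
        h * (rateMatrix q - Matrix.diagonal κ) k j) =
        u s j + h * Matrix.vecMul (u s) (rateMatrix q - Matrix.diagonal κ) j := by
      simp_rw [mul_add, Finset.sum_add_distrib, Matrix.one_apply, mul_ite, mul_one, mul_zero,
        Finset.sum_ite_eq', Finset.mem_univ, if_true, Matrix.vecMul, dotProduct, Finset.mul_sum]
      congr 1
      exact Finset.sum_congr rfl fun k _ => by ring
    rw [h2, h4] at h1
    rwa [sub_sub]
  have h0 : u 0 = fun i => ∫ ω in M t ⁻¹' {i}, X ω ∂P := by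
    funext i
    simp [u, Y, cumulativeIntensity]
  rw [← h0]
  exact congrFun (eq_vecMul_exp_of_eventually_abs_sub_le hu hstep hs) j

/-- With the weight `X` cut off to `{M t = i}`, the initial vector of the Feynman–Kac formula is a
multiple of the `i`-th unit vector, which picks out row `i` of the exponential. -/
theorem setIntegral_inter_exp_neg_cumulativeIntensity [IsProbabilityMeasure P]
    (hM : IsMarkovChainWithRates P q M) {κ : Fin r → ℝ} (hκ : ∀ i, 0 ≤ κ i) {t : ℝ} (ht : 0 ≤ t)
    {X : Ω → ℝ} (hX : AEStronglyMeasurable[sigmaOf M (Icc 0 t)] X P)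
    (hX1 : ∀ᵐ ω ∂P, |X ω| ≤ 1) {s : ℝ} (hs : 0 ≤ s) (i j : Fin r) :
    ∫ ω in M t ⁻¹' {i} ∩ M (t + s) ⁻¹' {j},
        X ω * Real.exp (-cumulativeIntensity κ (fun _ => 1) M t (t + s) ω) ∂P =
      (∫ ω in M t ⁻¹' {i}, X ω ∂P) *
        NormedSpace.exp (s • (rateMatrix q - Matrix.diagonal κ)) i j := by
  have hA := hM.measurableSet_fiber ht i
  have hm : MeasurableSet[sigmaOf M (Icc 0 t)] (M t ⁻¹' {i}) :=
    measurable_sigmaOf M (show t ∈ Icc 0 t from ⟨ht, le_rfl⟩) (measurableSet_singleton i)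
  have hXi : AEStronglyMeasurable[sigmaOf M (Icc 0 t)] ((M t ⁻¹' {i}).indicator X) P := by
    obtain ⟨Z, hZ, hXZ⟩ := hX
    exact ⟨_, hZ.indicator hm, hXZ.mono fun ω hω => by simp only [indicator, hω]⟩
  have h := hM.setIntegral_exp_neg_cumulativeIntensity hκ ht (X := (M t ⁻¹' {i}).indicator X)
    hXi ?_ hs j
  · have h1 : ∀ ω, (M t ⁻¹' {i}).indicator X ω *
        Real.exp (-cumulativeIntensity κ (fun _ => 1) M t (t + s) ω) = (M t ⁻¹' {i}).indicator
        (fun ω => X ω * Real.exp (-cumulativeIntensity κ (fun _ => 1) M t (t + s) ω)) ω :=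
      fun ω => by by_cases hω : ω ∈ M t ⁻¹' {i} <;> simp [hω]
    simp_rw [h1] at h
    rw [setIntegral_indicator hA, inter_comm] at h
    rw [h]
    have h2 : (fun k => ∫ ω in M t ⁻¹' {k}, (M t ⁻¹' {i}).indicator X ω ∂P) =
        Pi.single i (∫ ω in M t ⁻¹' {i}, X ω ∂P) := by
      funext k
      rw [setIntegral_indicator hA, ← preimage_inter]
      by_cases hk : k = i
      · subst hk
        simp
      · rw [singleton_inter_eq_empty.2 (by simpa using hk)]
        simp [hk]
    rw [h2, Matrix.single_vecMul]
    rfl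
  · filter_upwards [hX1] with ω hω
    by_cases hω' : ω ∈ M t ⁻¹' {i} <;> simp [hω', hω]

end IsMarkovChainWithRates

/-! ### Auxiliary facts on exposure, conditioning and Poisson weights -/

theorem LocallyBoundedVariationOn.intervalIntegrable {f : ℝ → ℝ} {s : Set ℝ}
    (hf : LocallyBoundedVariationOn f s) {a b : ℝ} (hs : uIcc a b ⊆ s) :
    IntervalIntegrable f volume a b := by
  obtain ⟨p, q, hp, hq, rfl⟩ := hf.exists_monotoneOn_sub_monotoneOn
  exact (hp.mono hs).intervalIntegrable.sub (hq.mono hs).intervalIntegrable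

theorem cond_real_apply_eq_of_inter {Ω : Type*} [MeasurableSpace Ω] {P : Measure Ω}
    [IsFiniteMeasure P] {s t : Set Ω} {c : ℝ} (hs : MeasurableSet s) (h0 : P s ≠ 0)
    (h : P.real (s ∩ t) = P.real s * c) : (P[|s]).real t = c := by
  rw [measureReal_def, cond_apply hs, ENNReal.toReal_mul, ENNReal.toReal_inv, ← measureReal_def,
    ← measureReal_def, h, inv_mul_cancel_left₀]
  simpa [measureReal_def, ENNReal.toReal_eq_zero_iff] using h0

/-- `c ^ n / n!` is a single term of the series of `exp c`. The bound makes the Poisson weight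
admissible as `X` in the Feynman–Kac formula. -/
theorem abs_exp_neg_mul_pow_div_factorial_le_one {c : ℝ} (hc : 0 ≤ c) (n : ℕ) :
    |Real.exp (-c) * c ^ n / (n)!| ≤ 1 := by
  rw [abs_of_nonneg (by positivity), mul_div_assoc]
  calc _ ≤ Real.exp (-c) * Real.exp c := by
        gcongr
        exact Real.pow_div_factorial_le_exp c hc n
    _ = 1 := by rw [← Real.exp_add, neg_add_cancel, Real.exp_zero]

theorem measurableSet_fiber_sigmaOf {Ω : Type*} {r : ℕ} (M : ℝ → Ω → Fin r) {t : ℝ}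
    (ht : 0 ≤ t) (i : Fin r) :
    MeasurableSet[sigmaOf M (Ici 0)] (M t ⁻¹' {i}) :=
  measurable_sigmaOf M (mem_Ici.2 ht) (measurableSet_singleton i)

theorem cumulativeIntensity_eq_of_const {Ω : Type*} {r : ℕ} {lam : Fin r → ℝ} {γ : ℝ → ℝ}
    {M : ℝ → Ω → Fin r} {t s g : ℝ} (hs : 0 ≤ s) (hγ : ∀ u ∈ Ico t (t + s), γ u = g) (ω : Ω) :
    cumulativeIntensity lam γ M t (t + s) ω =
      cumulativeIntensity (fun i => g * lam i) (fun _ => 1) M t (t + s) ω := by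
  have hts : t ≤ t + s := by linarith
  simp only [cumulativeIntensity, intervalIntegral.integral_of_le hts]
  -- The value of `γ` is prescribed on `[t, t + s)` while the integral runs over `(t, t + s]`; the
  -- endpoint is null.
  rw [integral_Ioc_eq_integral_Ioo, integral_Ioc_eq_integral_Ioo]
  refine setIntegral_congr_fun measurableSet_Ioo fun u hu => ?_
  simp only [hγ u ⟨hu.1.le, hu.2⟩]
  ring

/-! ### From conditional Poisson increments to joint probabilities -/

namespace IsMMNPP

variable {Ω : Type*} [MeasurableSpace Ω] {P : Measure Ω} {r : ℕ} {q : Fin r → Fin r → ℝ}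
  {lam : Fin r → ℝ} {γ : ℝ → ℝ} {M : ℝ → Ω → Fin r} {N : ℝ → Ω → ℕ}

/-- The conditional expectation is integrated over `D`. As the conditioning is on the whole path,
`D` may involve the regime at the end of the window. -/
theorem measureReal_inter_increments [IsFiniteMeasure P] (hMN : IsMMNPP P q lam γ M N)
    {m : ℕ} {τ : ℕ → ℝ} (n : ℕ → ℕ) (hτ : Monotone τ) (hτ0 : 0 ≤ τ 0) {D : Set Ω}
    (hD : MeasurableSet[sigmaOf M (Ici 0)] D) :
    P.real (D ∩ {ω | ∀ k < m, N (τ (k + 1)) ω = N (τ k) ω + n k}) =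
      ∫ ω in D, ∏ k ∈ Finset.range m,
        (Real.exp (-cumulativeIntensity lam γ M (τ k) (τ (k + 1)) ω) *
          cumulativeIntensity lam γ M (τ k) (τ (k + 1)) ω ^ n k / (n k)!) ∂P := by
  have hle : sigmaOf M (Ici 0) ≤ ‹MeasurableSpace Ω› :=
    sigmaOf_le fun s hs => hMN.chain.measurable s hs
  have hNm : ∀ k, Measurable (N (τ k)) := fun k =>
    hMN.measurable _ (hτ0.trans (hτ (Nat.zero_le k)))
  have hE : MeasurableSet {ω | ∀ k < m, N (τ (k + 1)) ω = N (τ k) ω + n k} := by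
    simp only [ofPred_forall]
    exact MeasurableSet.iInter fun k => MeasurableSet.iInter fun _ =>
      measurableSet_eq_fun (hNm _) ((hNm k).add_const _)
  rw [← setIntegral_congr_ae (hle D hD) ((hMN.condPoisson m τ n hτ hτ0).mono fun ω h _ => h),
    setIntegral_condExp hle ((integrable_const _).indicator hE) hD, setIntegral_indicator hE,
    setIntegral_const, smul_eq_mul, mul_one]

variable [IsProbabilityMeasure P] {t s g : ℝ}

theorem measureReal_noArrival (hMN : IsMMNPP P q lam γ M N) (hlam : ∀ i, 0 ≤ lam i)
    (ht : 0 ≤ t) (hs : 0 ≤ s) (hg : 0 ≤ g) (hγ : ∀ u ∈ Ico t (t + s), γ u = g) (i j : Fin r) :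
    P.real ({ω | M t ω = i} ∩ {ω | M (t + s) ω = j ∧ N (t + s) ω = N t ω}) =
      P.real {ω | M t ω = i} *
        NormedSpace.exp (s • (rateMatrix q - g • Matrix.diagonal lam)) i j := by
  have hts : t ≤ t + s := by linarith
  have hκ : ∀ i, 0 ≤ g * lam i := fun i => mul_nonneg hg (hlam i)
  have h1 := hMN.measureReal_inter_increments (m := 1) (τ := fun k => if k = 0 then t else t + s)
    (fun _ => 0) (monotone_nat_of_le_succ fun k => by rcases k with _ | k <;> simp [hs]) (by simpa)
    ((measurableSet_fiber_sigmaOf M ht i).inter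
      (measurableSet_fiber_sigmaOf M (ht.trans hts) j))
  have h2 := hMN.chain.setIntegral_inter_exp_neg_cumulativeIntensity hκ ht (X := fun _ => 1)
    (@aestronglyMeasurable_const _ _ (_) (_) _ _ _) (by simp) hs i j
  simp only [Finset.range_one, Finset.prod_singleton, zero_add, if_true, one_ne_zero, if_false,
    pow_zero, mul_one, Nat.factorial_zero, Nat.cast_one, div_one,
    cumulativeIntensity_eq_of_const hs hγ] at h1
  simp only [one_mul, setIntegral_const, smul_eq_mul, mul_one] at h2
  have h3 : g • Matrix.diagonal lam = Matrix.diagonal fun i => g * lam i := by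
    rw [← Matrix.diagonal_smul]
    rfl
  rw [h3]
  refine Eq.trans ?_ (h1.trans h2)
  congr 1
  ext ω
  simp [and_assoc]

/-- Two increments are prescribed: `n` events on `(0, t]` and none on `(t, t + s]`. The first
contributes the weight `X`, the second the exponential. The integral of `X` over `{M t = i}` is the
probability of the conditioning event, because `N 0 = 0` almost surely. -/
theorem measureReal_noArrivalGiven (hMN : IsMMNPP P q lam γ M N) (hlam : ∀ i, 0 ≤ lam i)
    (hγ_nonneg : ∀ u, 0 ≤ u → 0 ≤ γ u) (hγ_bv : LocallyBoundedVariationOn γ (Ici 0))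
    (ht : 0 ≤ t) (hs : 0 ≤ s) (hg : 0 ≤ g) (hγ : ∀ u ∈ Ico t (t + s), γ u = g) (i j : Fin r)
    (n : ℕ) :
    P.real ({ω | M t ω = i ∧ N t ω = n} ∩ {ω | M (t + s) ω = j ∧ N (t + s) ω = n}) =
      P.real {ω | M t ω = i ∧ N t ω = n} *
        NormedSpace.exp (s • (rateMatrix q - g • Matrix.diagonal lam)) i j := by
  have hts : t ≤ t + s := by linarith
  have hκ : ∀ i, 0 ≤ g * lam i := fun i => mul_nonneg hg (hlam i)
  have h1 := hMN.measureReal_inter_increments (m := 2)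
    (τ := fun k => if k = 0 then 0 else if k = 1 then t else t + s)
    (fun k => if k = 0 then n else 0)
    (monotone_nat_of_le_succ fun k => by rcases k with _ | _ | k <;> simp [hs, ht]) (by simp)
    ((measurableSet_fiber_sigmaOf M ht i).inter
      (measurableSet_fiber_sigmaOf M (ht.trans hts) j))
  have h0 := hMN.measureReal_inter_increments (m := 1)
    (τ := fun k => if k = 0 then 0 else t) (fun _ => n)
    (monotone_nat_of_le_succ fun k => by rcases k with _ | k <;> simp [ht]) (by simp)
    (measurableSet_fiber_sigmaOf M ht i)
  -- Before `t` the exposure is not constant; bounded variation provides its integrability on `[0,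
  -- t]`.
  have hc : AEStronglyMeasurable[sigmaOf M (Icc 0 t)] (cumulativeIntensity lam γ M 0 t) P :=
    hMN.chain.aestronglyMeasurable_cumulativeIntensity lam le_rfl ht
      (hγ_bv.intervalIntegrable (by rw [uIcc_of_le ht]; exact Icc_subset_Ici_self))
  have h2 := hMN.chain.setIntegral_inter_exp_neg_cumulativeIntensity hκ ht
    (X := fun ω => Real.exp (-cumulativeIntensity lam γ M 0 t ω) *
      cumulativeIntensity lam γ M 0 t ω ^ n / (n)!)
    ((show Continuous fun c : ℝ => Real.exp (-c) * c ^ n / (n)! by fun_prop).comp_aestronglyMeasurable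
      hc)
    (Eventually.of_forall fun ω => abs_exp_neg_mul_pow_div_factorial_le_one
      (cumulativeIntensity_nonneg hlam hγ_nonneg M le_rfl ht ω) n) hs i j
  simp only [Finset.range_one, Finset.prod_singleton, zero_add, if_true, one_ne_zero,
    if_false] at h0
  simp only [Finset.prod_range_succ, Finset.range_zero, Finset.prod_empty, one_mul, zero_add,
    if_true, one_ne_zero, if_false, one_add_one_eq_two, OfNat.ofNat_ne_zero, OfNat.ofNat_ne_one,
    pow_zero, mul_one, Nat.factorial_zero, Nat.cast_one, div_one,
    cumulativeIntensity_eq_of_const hs hγ] at h1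
  have h3 : g • Matrix.diagonal lam = Matrix.diagonal fun i => g * lam i := by
    rw [← Matrix.diagonal_smul]
    rfl
  rw [h3]
  have h4 : P.real {ω | M t ω = i ∧ N t ω = n} = ∫ ω in M t ⁻¹' {i},
      Real.exp (-cumulativeIntensity lam γ M 0 t ω) *
        cumulativeIntensity lam γ M 0 t ω ^ n / (n)! ∂P := by
    refine Eq.trans (measureReal_congr ?_) h0
    filter_upwards [hMN.start] with ω hω
    refine propext ?_
    change (M t ω = i ∧ N t ω = n) ↔ (M t ω = i ∧
      ∀ k < 1, N (if k + 1 = 0 then 0 else t) ω = N (if k = 0 then 0 else t) ω + n)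
    simp [hω]
  rw [h4, ← h2]
  refine Eq.trans (measureReal_congr ?_) h1
  filter_upwards [hMN.start] with ω hω
  refine propext ?_
  change ((M t ω = i ∧ N t ω = n) ∧ M (t + s) ω = j ∧ N (t + s) ω = n) ↔
    ((M t ω = i ∧ M (t + s) ω = j) ∧ ∀ k < 2,
      N (if k + 1 = 0 then 0 else if k + 1 = 1 then t else t + s) ω =
        N (if k = 0 then 0 else if k = 1 then t else t + s) ω + if k = 0 then n else 0)
  have h5 : (∀ k < 2, N (if k + 1 = 0 then 0 else if k + 1 = 1 then t else t + s) ω =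
      N (if k = 0 then 0 else if k = 1 then t else t + s) ω + if k = 0 then n else 0) ↔
      N t ω = n ∧ N (t + s) ω = N t ω := by
    constructor
    · intro h
      exact ⟨by simpa [hω] using h 0 two_pos, by simpa using h 1 one_lt_two⟩
    · rintro ⟨ha, hb⟩ k hk
      interval_cases k
      · simpa [hω] using ha
      · simpa using hb
  rw [h5]
  grind

end IsMMNPP
theorem theorem2 {Ω : Type*} [MeasurableSpace Ω] (P : Measure Ω) [IsProbabilityMeasure P]
    {r : ℕ} (q : Fin r → Fin r → ℝ) (hq : ∀ i j, i ≠ j → 0 ≤ q i j)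
    (lam : Fin r → ℝ) (hlam : ∀ i, 0 ≤ lam i)
    (γ : ℝ → ℝ) (hγ_nonneg : ∀ u, 0 ≤ u → 0 ≤ γ u)
    (hγ_bv : LocallyBoundedVariationOn γ (Ici 0))
    (M : ℝ → Ω → Fin r) (N : ℝ → Ω → ℕ) (hMN : IsMMNPP P q lam γ M N)
    (t tstar : ℝ) (ht : 0 ≤ t) (htstar : 0 ≤ tstar)
    (g : ℝ) (hγ_const : ∀ u ∈ Ico t (t + tstar), γ u = g) :
    (∀ i, P {ω | M t ω = i} ≠ 0 →
      noArrivalMatrix P M N t tstar i =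
        NormedSpace.exp (tstar • (rateMatrix q - g • Matrix.diagonal lam)) i) ∧
    (∀ i n, P {ω | M t ω = i ∧ N t ω = n} ≠ 0 →
      noArrivalMatrixGiven P M N n t tstar i =
        NormedSpace.exp (tstar • (rateMatrix q - g • Matrix.diagonal lam)) i) := by
  -- If `tstar = 0` the window is empty and `g` may be negative; it is replaced by `0`, the exponent
  -- being zero anyway. Otherwise `g = γ t ≥ 0`.
  obtain ⟨g', hg', hγ', hgg'⟩ : ∃ g', 0 ≤ g' ∧ (∀ u ∈ Ico t (t + tstar), γ u = g') ∧
      tstar • (rateMatrix q - g • Matrix.diagonal lam) =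
        tstar • (rateMatrix q - g' • Matrix.diagonal lam) := by
    rcases htstar.eq_or_lt with h | h
    · exact ⟨0, le_rfl, by simp [← h], by simp [← h]⟩
    · have ht' : t ∈ Ico t (t + tstar) := ⟨le_rfl, by linarith⟩
      exact ⟨g, hγ_const t ht' ▸ hγ_nonneg t ht, hγ_const, rfl⟩
  rw [hgg']
  refine ⟨fun i h0 => funext fun j => ?_, fun i n h0 => funext fun j => ?_⟩
  · exact cond_real_apply_eq_of_inter (hMN.chain.measurableSet_fiber ht i) h0
      (hMN.measureReal_noArrival hlam ht htstar hg' hγ' i j)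
  · exact cond_real_apply_eq_of_inter ((hMN.chain.measurableSet_fiber ht i).inter
      (hMN.measurable t ht (measurableSet_singleton n))) h0
      (hMN.measureReal_noArrivalGiven hlam hγ_nonneg hγ_bv ht htstar hg' hγ' i j n)
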